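/- Let $d$ be a natural number. A \emph{signal} is a finite combination $F=\sum_{j=1}^{s}\sum_{\ell=0}^{d_j-1}a_{j,\ell}\,\delta^{(\ell)}(x-x_j)$, where $s\ge 0$, the nodes $x_1,\dots,x_s\in\mathbb{C}$ are pairwise distinct, $d_j\ge 1$, $a_{j,\ell}\in\mathbb{C}$ and $a_{j,d_j-1}\neq 0$ for all $j$; its rank is $\sum_{j}d_j$. Given $\mu=(m_0,\dots,m_{2d-1})\in\mathbb{C}^{2d}$, a \emph{solution of the Prony problem of order $d$ with right-hand side $\mu$} is a signal $F$ of rank at most $d$ such that $$\sum_{j=1}^{s}\sum_{\ell=0}^{d_j-1}\frac{k!}{(k-\ell)!}\,a_{j,\ell}\,x_j^{k-\ell}=m_k,\qquad k=0,1,\dots,2d-1,$$ where the terms with $\ell>k$ are read as $0$. Let $\Sigma'\subset\mathbb{C}^{2d}$ be the set of those $\mu$ for which the Prony problem of order $d$ has no solution. **Theorem.** Let $\mu_0\in\Sigma'$. As $\mu\in\mathbb{C}^{2d}\setminus\Sigma'$ tends to $\mu_0$, at least one of the nodes in the solution of the Prony problem with right-hand side $\mu$ tends to infinity. That is, for every $R>0$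 there is $\varepsilon>0$ such that for every $\mu\in\mathbb{C}^{2d}\setminus\Sigma'$ with $\|\mu-\mu_0\|<\varepsilon$, every solution of the Prony problem with right-hand side $\mu$ has a node $x_j$ with $|x_j|>R$. -/

import Mathlib

open Filter Topology

/-- A signal `F(x) = ∑_{j=1}^{s} ∑_{ℓ=0}^{d_j - 1} a_{j,ℓ} δ^{(ℓ)}(x - x_j)` with complex
coefficients: pairwise distinct nodes `x_j`, multiplicity vector `(d_1, …, d_s)` with `d_j ≥ 1`,
and nonzero top coefficients `a_{j, d_j - 1}`. The zero signal is the case `s = 0`. -/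
structure ConfluentSignal where
  /-- the number of nodes -/
  s : ℕ
  /-- the multiplicity vector -/
  mult : Fin s → ℕ
  mult_pos : ∀ j, 0 < mult j
  /-- the nodes -/
  node : Fin s → ℂ
  node_injective : Function.Injective node
  /-- the coefficients `a_{j,ℓ}`, `0 ≤ ℓ < d_j` -/
  coeff : (j : Fin s) → Fin (mult j) → ℂ
  coeff_top_ne_zero : ∀ j, coeff j ⟨mult j - 1, Nat.sub_lt (mult_pos j) Nat.one_pos⟩ ≠ 0

namespace ConfluentSignal

/-- The rank of a signal, i.e. the order of its multiplicity vector. -/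
def rank (F : ConfluentSignal) : ℕ := ∑ j, F.mult j

/-- The moment `m_k(F) = ∑_j ∑_{ℓ < d_j} a_{j,ℓ} (k! / (k - ℓ)!) x_j^{k - ℓ}`. The factor
`k! / (k - ℓ)! = k (k - 1) ⋯ (k - ℓ + 1)` is the falling factorial, which is `0` for `ℓ > k`. -/
def moment (F : ConfluentSignal) (k : ℕ) : ℂ :=
  ∑ j, ∑ ℓ : Fin (F.mult j),
    (k.descFactorial (ℓ : ℕ) : ℂ) * F.coeff j ℓ * F.node j ^ (k - (ℓ : ℕ))

end ConfluentSignal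

/-- `F` solves the Prony problem of order `d` with right-hand side `μ = (m_0, …, m_{2d-1})`:
its rank is at most `d`, and it satisfies the confluent Prony system. -/
def IsPronySolution (d : ℕ) (μ : Fin (2 * d) → ℂ) (F : ConfluentSignal) : Prop :=
  F.rank ≤ d ∧ ∀ k : Fin (2 * d), F.moment (k : ℕ) = μ k

/-- The set `Σ' ⊆ ℂ^{2d}` of right-hand sides for which the Prony problem of order `d` has no
solution. -/
def pronyUnsolvableSet (d : ℕ) : Set (Fin (2 * d) → ℂ) :=
  {μ | ¬ ∃ F : ConfluentSignal, IsPronySolution d μ F}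

/-! For monic `q` of degree `d`, the recurrence `L (X ^ k * q) = 0`, `k < d`, forces solvability
(`exists_isPronySolution_of_recurrence`). Conversely, a solution with nodes in a disc gives such a
`q` with roots in that disc (`IsPronySolution.exists_recurrence`). Compactness of the disc makes the
set of `μ` admitting such a `q` closed (`isClosed_setOf_recurrence`). It misses `μ₀`, hence a
neighbourhood of `μ₀`. -/

namespace Polynomial

/-- The functional `p ↦ p^{(ℓ)}(r)` on polynomials. -/
noncomputable def derivEval (r : ℂ) (ℓ : ℕ) : ℂ[X] →ₗ[ℂ] ℂ :=
  leval r ∘ₗ (derivative ^ ℓ)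

theorem derivEval_apply (r : ℂ) (ℓ : ℕ) (p : ℂ[X]) :
    derivEval r ℓ p = (derivative^[ℓ] p).eval r := by
  simp [derivEval, Module.End.pow_apply]

theorem derivEval_X_pow (r : ℂ) (ℓ k : ℕ) :
    derivEval r ℓ (X ^ k) = (k.descFactorial ℓ : ℂ) * r ^ (k - ℓ) := by
  rw [derivEval_apply, iterate_derivative_X_pow_eq_natCast_mul]
  simp

theorem derivEval_eq_zero_of_pow_dvd {r : ℂ} {n ℓ : ℕ} (hℓ : ℓ < n) {p : ℂ[X]}
    (h : (X - C r) ^ n ∣ p) : derivEval r ℓ p = 0 := by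
  rcases eq_or_ne p 0 with rfl | hp
  · simp
  rw [derivEval_apply]
  exact (lt_rootMultiplicity_iff_isRoot_iterate_derivative hp).1
    (hℓ.trans_le ((le_rootMultiplicity_iff hp).2 h)) ℓ le_rfl

/-- Over `ℂ`, `q` splits, so divisibility is a comparison of root multiplicities. -/
theorem dvd_of_forall_derivEval_eq_zero {q p : ℂ[X]} (hq : q ≠ 0)
    (h : ∀ r ∈ q.roots, ∀ ℓ < q.rootMultiplicity r, derivEval r ℓ p = 0) : q ∣ p := by
  rcases eq_or_ne p 0 with rfl | hp
  · simp
  rw [(IsAlgClosed.splits q).dvd_iff_roots_le_roots hq hp, Multiset.le_iff_count]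
  intro r
  rw [count_roots, count_roots]
  rcases Nat.eq_zero_or_pos (q.rootMultiplicity r) with h0 | h0
  · omega
  have hr : r ∈ q.roots := by rwa [← Multiset.count_pos, count_roots]
  have := (lt_rootMultiplicity_iff_isRoot_iterate_derivative (t := r)
    (n := q.rootMultiplicity r - 1) hp).2 fun m hm => by
      rw [IsRoot, ← derivEval_apply]
      exact h r hr m (by omega)
  omega

/-- A functional vanishing on the multiples of `q` is a combination of the functionals
`p ↦ p^{(ℓ)}(r)`, with `r` a root of `q` and `ℓ` below its multiplicity. -/
theorem exists_eq_sum_derivEval {q : ℂ[X]} (hq : q ≠ 0) (L : ℂ[X] →ₗ[ℂ] ℂ)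
    (hL : ∀ p, q ∣ p → L p = 0) :
    ∃ c : (Σ r : q.roots.toFinset, Fin (q.rootMultiplicity (r : ℂ))) → ℂ,
      ∀ p, L p = ∑ i, c i * derivEval i.1 i.2 p := by
  have hmem : L ∈ Submodule.span ℂ (Set.range
      fun i : (Σ r : q.roots.toFinset, Fin (q.rootMultiplicity (r : ℂ))) => derivEval i.1 i.2) := by
    -- A functional vanishing on the common kernel of finitely many functionals lies in their span.
    refine mem_span_of_iInf_ker_le_ker fun p hp => ?_
    simp only [Submodule.mem_iInf, LinearMap.mem_ker] at hp ⊢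
    exact hL p (dvd_of_forall_derivEval_eq_zero hq fun r hr ℓ hℓ =>
      hp ⟨⟨r, Multiset.mem_toFinset.2 hr⟩, ⟨ℓ, hℓ⟩⟩)
  obtain ⟨c, hc⟩ := (Submodule.mem_span_range_iff_exists_fun ℂ).1 hmem
  exact ⟨c, fun p => by simp [← hc, LinearMap.sum_apply]⟩

theorem continuous_coeff_prod_X_sub_C {ι : Type*} (s : Finset ι) (n : ℕ) :
    Continuous fun x : ι → ℂ => (∏ i ∈ s, (X - C (x i))).coeff n := by
  classical
  induction s using Finset.induction_on generalizing n with
  | empty => simpa using continuous_const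
  | insert a s ha ih =>
    simp only [Finset.prod_insert ha, coeff_mul, coeff_sub, coeff_C]
    refine continuous_finsetSum _ fun i _ => (continuous_const.sub ?_).mul (ih _)
    split_ifs <;> fun_prop

end Polynomial

namespace ConfluentSignal

open Polynomial

/-- The functional `p ↦ ∑_j ∑_ℓ a_{j,ℓ} p^{(ℓ)}(x_j)` on polynomials defined by a signal. -/
noncomputable def functional (F : ConfluentSignal) : ℂ[X] →ₗ[ℂ] ℂ :=
  ∑ j, ∑ ℓ : Fin (F.mult j), F.coeff j ℓ • derivEval (F.node j) ℓ

theorem functional_apply (F : ConfluentSignal) (p : ℂ[X]) :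
    F.functional p = ∑ j, ∑ ℓ : Fin (F.mult j), F.coeff j ℓ * derivEval (F.node j) ℓ p := by
  simp [functional, LinearMap.sum_apply]

theorem functional_X_pow (F : ConfluentSignal) (k : ℕ) : F.functional (X ^ k) = F.moment k := by
  simp only [functional_apply, moment, derivEval_X_pow]
  exact Finset.sum_congr rfl fun j _ => Finset.sum_congr rfl fun ℓ _ => by ring

theorem functional_eq_zero (F : ConfluentSignal) {p : ℂ[X]}
    (h : ∀ j, (X - C (F.node j)) ^ F.mult j ∣ p) : F.functional p = 0 := by
  rw [functional_apply]
  exact Finset.sum_eq_zero fun j _ => Finset.sum_eq_zero fun ℓ _ => by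
    rw [derivEval_eq_zero_of_pow_dvd ℓ.2 (h j), mul_zero]

/-- A family of coefficient polynomials at distinct nodes, possibly with vanishing members,
defines a signal. -/
theorem exists_functional_eq_sum {ι : Type*} [Fintype ι] (x : ι → ℂ) (hx : Function.Injective x)
    (n : ι → ℕ) (c : (i : ι) → Fin (n i) → ℂ) :
    ∃ F : ConfluentSignal, F.rank ≤ ∑ i, n i ∧
      ∀ p, F.functional p = ∑ i, ∑ ℓ : Fin (n i), c i ℓ * derivEval (x i) ℓ p := by
  classical
  -- With the coefficients at a node packed into a polynomial, `natDegree + 1` is the true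
  -- multiplicity and the leading coefficient the nonzero top one; nodes with `g i = 0` are dropped.
  let g : ι → ℂ[X] := fun i => ∑ ℓ : Fin (n i), monomial (ℓ : ℕ) (c i ℓ)
  have hcoeff : ∀ i (ℓ : Fin (n i)), (g i).coeff ℓ = c i ℓ := fun i ℓ => by
    simp [g, finsetSum_coeff, coeff_monomial, Fin.val_inj]
  have hdeg : ∀ i, g i ≠ 0 → (g i).natDegree + 1 ≤ n i := fun i hi => by
    by_contra hlt
    refine leadingCoeff_ne_zero.2 hi ?_
    rw [leadingCoeff, finsetSum_coeff]
    exact Finset.sum_eq_zero fun ℓ _ => by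
      rw [coeff_monomial, if_neg]
      have := ℓ.2
      omega
  let e := Fintype.equivFin {i // g i ≠ 0}
  have hsum : ∀ {M : Type} [AddCommMonoid M] (f : ι → M), (∀ i, g i = 0 → f i = 0) →
      ∑ j, f (e.symm j) = ∑ i, f i := fun f hf => by
    rw [Equiv.sum_comp e.symm (fun i => f i),
      ← Finset.sum_subtype (Finset.univ.filter fun i => g i ≠ 0) (by simp) f]
    exact Finset.sum_filter_of_ne fun i _ hi h => hi (hf i h)
  clear_value g e
  refine ⟨⟨Fintype.card {i // g i ≠ 0}, fun j => (g (e.symm j)).natDegree + 1,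
    fun j => Nat.succ_pos _, fun j => x (e.symm j),
    hx.comp (Subtype.val_injective.comp e.symm.injective),
    fun j ℓ => (g (e.symm j)).coeff ℓ,
    fun j => leadingCoeff_ne_zero.2 (e.symm j).2⟩, ?_, fun p => ?_⟩
  · calc ∑ j, ((g (e.symm j)).natDegree + 1)
        = ∑ j, (if g (e.symm j) = 0 then 0 else (g (e.symm j)).natDegree + 1) :=
          Finset.sum_congr rfl fun j _ => (if_neg (e.symm j).2).symm
      _ = ∑ i, if g i = 0 then 0 else (g i).natDegree + 1 :=
          hsum (fun i => if g i = 0 then 0 else (g i).natDegree + 1) fun i hi => if_pos hi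
      _ ≤ ∑ i, n i := Finset.sum_le_sum fun i _ => by
          split_ifs with hi
          · exact Nat.zero_le _
          · exact hdeg i hi
  · rw [functional_apply]
    have hinner : ∀ i, ∑ ℓ : Fin (n i), c i ℓ * derivEval (x i) ℓ p =
        ∑ ℓ ∈ Finset.range (n i), (g i).coeff ℓ * derivEval (x i) ℓ p := fun i => by
      rw [← Fin.sum_univ_eq_sum_range fun ℓ => (g i).coeff ℓ * derivEval (x i) ℓ p]
      simp only [hcoeff]
    simp only [hinner]
    rw [← hsum _ fun i hi => by simp [hi]]
    refine Finset.sum_congr rfl fun j _ => ?_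
    rw [Fin.sum_univ_eq_sum_range
      fun ℓ => (g (e.symm j)).coeff ℓ * derivEval (x (e.symm j)) ℓ p]
    refine Finset.sum_subset (Finset.range_mono (hdeg _ (e.symm j).2)) fun ℓ _ hℓ => ?_
    rw [coeff_eq_zero_of_natDegree_lt (by simpa [Nat.lt_succ_iff] using hℓ), zero_mul]

end ConfluentSignal

section Prony

open Polynomial

/-- The functional `X ^ k ↦ μ k` on polynomials of degree less than `N`, extended by zero. -/
noncomputable def sequenceFunctional {N : ℕ} (μ : Fin N → ℂ) : ℂ[X] →ₗ[ℂ] ℂ :=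
  ∑ i : Fin N, μ i • lcoeff ℂ (i : ℕ)

theorem sequenceFunctional_apply {N : ℕ} (μ : Fin N → ℂ) (p : ℂ[X]) :
    sequenceFunctional μ p = ∑ i : Fin N, μ i * p.coeff i := by
  simp [sequenceFunctional, LinearMap.sum_apply]

theorem sequenceFunctional_X_pow {N : ℕ} (μ : Fin N → ℂ) (k : Fin N) :
    sequenceFunctional μ (X ^ (k : ℕ)) = μ k := by
  simp [sequenceFunctional_apply, coeff_X_pow, Fin.val_inj]

theorem sequenceFunctional_eq {N : ℕ} {μ : Fin N → ℂ} {L : ℂ[X] →ₗ[ℂ] ℂ}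
    (h : ∀ k : Fin N, L (X ^ (k : ℕ)) = μ k) {p : ℂ[X]} (hp : p.natDegree < N) :
    sequenceFunctional μ p = L p := by
  conv_rhs => rw [p.as_sum_range' N hp, map_sum]
  rw [sequenceFunctional_apply,
    ← Fin.sum_univ_eq_sum_range fun i => L (monomial i (p.coeff i))]
  refine Finset.sum_congr rfl fun i _ => ?_
  rw [← h i, ← mul_one (p.coeff i), ← smul_eq_mul (p.coeff i) 1, ← smul_monomial, map_smul,
    monomial_one_right_eq_X_pow, smul_eq_mul, smul_eq_mul, mul_one, mul_comm]

/-- If the sequence `μ` satisfies the linear recurrence with monic characteristic polynomial `q`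
of degree `d`, then the Prony problem of order `d` with right-hand side `μ` is solvable. -/
theorem exists_isPronySolution_of_recurrence {d : ℕ} {μ : Fin (2 * d) → ℂ} {q : ℂ[X]}
    (hq : q.Monic) (hqd : q.natDegree = d)
    (h : ∀ k < d, sequenceFunctional μ (X ^ k * q) = 0) :
    ∃ F : ConfluentSignal, IsPronySolution d μ F := by
  -- Reducing modulo `q` first makes the functional vanish on all multiples of `q`.
  let L : ℂ[X] →ₗ[ℂ] ℂ := sequenceFunctional μ ∘ₗ modByMonicHom q
  obtain ⟨c, hc⟩ := exists_eq_sum_derivEval hq.ne_zero L fun p hp => by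
    simp [L, modByMonicHom, (modByMonic_eq_zero_iff_dvd hq).2 hp]
  obtain ⟨F, hF, hFL⟩ := ConfluentSignal.exists_functional_eq_sum
    (fun r : q.roots.toFinset => (r : ℂ)) Subtype.val_injective
    (fun r => q.rootMultiplicity (r : ℂ)) (fun r ℓ => c ⟨r, ℓ⟩)
  refine ⟨F, hF.trans ?_, fun k => ?_⟩
  · rw [Finset.sum_coe_sort q.roots.toFinset fun r => q.rootMultiplicity r]
    simp only [← count_roots]
    rw [Multiset.toFinset_sum_count_eq, ← hqd]
    exact card_roots' q
  -- As `k < 2 * d`, the quotient has degree below `d`, exactly the range covered by the recurrence.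
  · have hdiv : (X ^ (k : ℕ) /ₘ q : ℂ[X]).natDegree < d := by
      rw [natDegree_divByMonic _ hq, natDegree_X_pow]
      omega
    have hzero : sequenceFunctional μ (q * (X ^ (k : ℕ) /ₘ q)) = 0 := by
      rw [(X ^ (k : ℕ) /ₘ q : ℂ[X]).as_sum_range' d hdiv, Finset.mul_sum, map_sum]
      refine Finset.sum_eq_zero fun i hi => ?_
      rw [← C_mul_X_pow_eq_monomial, mul_left_comm, ← smul_eq_C_mul, map_smul, mul_comm q,
        h i (Finset.mem_range.1 hi), smul_zero]
    rw [← F.functional_X_pow, hFL, ← Fintype.sum_sigma', ← hc, ← sequenceFunctional_X_pow μ k]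
    conv_rhs => rw [← modByMonic_add_div (X ^ (k : ℕ)) q, map_add, hzero, add_zero]
    rfl

/-- The moments of a signal of rank at most `d` with nodes in a disc around the origin satisfy a
linear recurrence whose characteristic polynomial has degree `d` and all its roots in the disc. -/
theorem IsPronySolution.exists_recurrence {d : ℕ} {μ : Fin (2 * d) → ℂ} {F : ConfluentSignal}
    (hF : IsPronySolution d μ F) {R : ℝ} (hR : 0 ≤ R) (hnode : ∀ j, ‖F.node j‖ ≤ R) :
    ∃ x : Fin d → ℂ, (∀ i, ‖x i‖ ≤ R) ∧
      ∀ k < d, sequenceFunctional μ (X ^ k * ∏ i, (X - C (x i))) = 0 := by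
  -- The nodes, repeated by multiplicity, are padded to length `d` with zeros, which lie in the
  -- disc.
  let e : Fin d ≃ (Σ j, Fin (F.mult j)) ⊕ Fin (d - F.rank) :=
    (Fintype.equivFinOfCardEq (by
      have := hF.1
      simp only [Fintype.card_sum, Fintype.card_sigma, Fintype.card_fin]
      change F.rank + _ = d
      omega)).symm
  let y : (Σ j, Fin (F.mult j)) ⊕ Fin (d - F.rank) → ℂ := Sum.elim (fun i => F.node i.1) 0
  refine ⟨y ∘ e, fun i => ?_, fun k hk => ?_⟩
  · rw [Function.comp_apply]
    rcases e i with i | i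
    · exact hnode i.1
    · simpa [y] using hR
  · rw [sequenceFunctional_eq (L := F.functional)
      (fun k => (F.functional_X_pow k).trans (hF.2 k)), F.functional_eq_zero]
    · intro j
      refine Dvd.dvd.mul_left ?_ _
      simp only [Function.comp_apply]
      rw [Equiv.prod_comp e fun i => X - C (y i), Fintype.prod_sum_type, Fintype.prod_sigma]
      refine Dvd.dvd.mul_right ?_ _
      simpa [y] using Finset.dvd_prod_of_mem
        (fun j => (X - C (F.node j)) ^ F.mult j) (Finset.mem_univ j)
    · refine natDegree_mul_le.trans_lt ?_
      rw [natDegree_X_pow, natDegree_finsetProd_X_sub_C_eq_card, Finset.card_univ,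
        Fintype.card_fin]
      omega

/-- The right-hand sides satisfying a recurrence whose characteristic polynomial has degree `d` and
all its roots in a given disc form a closed set. -/
theorem isClosed_setOf_recurrence (N d : ℕ) (R : ℝ) :
    IsClosed {μ : Fin N → ℂ | ∃ x : Fin d → ℂ, (∀ i, ‖x i‖ ≤ R) ∧
      ∀ k < d, sequenceFunctional μ (X ^ k * ∏ i, (X - C (x i))) = 0} := by
  let K : Set (Fin d → ℂ) := Set.univ.pi fun _ => Metric.closedBall 0 R
  have hK : IsCompact K := isCompact_univ_pi fun _ => isCompact_closedBall 0 R
  have : CompactSpace K := isCompact_iff_compactSpace.1 hK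
  have hcoeff : ∀ k n : ℕ, Continuous fun z : (Fin N → ℂ) × K =>
      (X ^ k * ∏ i, (X - C ((z.2 : Fin d → ℂ) i))).coeff n := fun k n => by
    simp only [coeff_X_pow_mul']
    split_ifs
    · exact (continuous_coeff_prod_X_sub_C Finset.univ (n - k)).comp
        (continuous_subtype_val.comp continuous_snd)
    · exact continuous_const
  have hclosed : IsClosed {z : (Fin N → ℂ) × K |
      ∀ k < d, sequenceFunctional z.1 (X ^ k * ∏ i, (X - C ((z.2 : Fin d → ℂ) i))) = 0} := by
    simp only [Set.ofPred_forall, sequenceFunctional_apply]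
    refine isClosed_iInter fun k => isClosed_iInter fun _ => isClosed_eq ?_ continuous_const
    exact continuous_finsetSum _ fun i _ =>
      ((continuous_apply i).comp continuous_fst).mul (hcoeff k i)
  -- Projection along the compact factor `K` is a closed map.
  convert isClosedMap_fst_of_compactSpace _ hclosed using 1
  ext μ
  constructor
  · rintro ⟨x, hx, h⟩
    exact ⟨(μ, ⟨x, fun i _ => mem_closedBall_zero_iff.2 (hx i)⟩), h, rfl⟩
  · rintro ⟨⟨_, x⟩, h, rfl⟩
    exact ⟨x, fun i => mem_closedBall_zero_iff.1 (x.2 i trivial), h⟩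

end Prony

/-- As `μ ∈ ℂ^{2d} ∖ Σ'` tends to `μ₀ ∈ Σ'`, at least one node of the solution of the Prony problem
tends to infinity: for every `R`, for all `μ ∉ Σ'` close enough to `μ₀`, the solution has a node of
modulus larger than `R`. -/
theorem mainTheorem5 (d : ℕ) (μ₀ : Fin (2 * d) → ℂ) (hμ₀ : μ₀ ∈ pronyUnsolvableSet d) :
    ∀ R : ℝ, ∀ᶠ μ in 𝓝[(pronyUnsolvableSet d)ᶜ] μ₀,
      ∀ F : ConfluentSignal, IsPronySolution d μ F → ∃ j, R < ‖F.node j‖ := by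
  intro R
  refine eventually_nhdsWithin_of_eventually_nhds ?_
  -- The radius is `|R|` because the padding zeros need a nonnegative one.
  filter_upwards [(isClosed_setOf_recurrence (2 * d) d |R|).isOpen_compl.mem_nhds fun ⟨x, _, h⟩ =>
    hμ₀ (exists_isPronySolution_of_recurrence (Polynomial.monic_prod_X_sub_C _ _)
      (by simp [Polynomial.natDegree_finsetProd_X_sub_C_eq_card]) h)] with μ hμ F hF
  by_contra! hnode
  exact hμ (hF.exists_recurrence (abs_nonneg R) fun j => (hnode j).trans (le_abs_self R))
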